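/- Let $\mathcal H$ be a complex Hilbert space, finite-dimensional or separable infinite-dimensional, with $\dim\mathcal H\ge 2$. A state is a positive trace class operator $\varrho$ on $\mathcal H$ with $\operatorname{tr}\varrho=1$. An observable $\mathsf A$ is a map $x\mapsto\mathsf A(x)$ from a finite set $\Omega_{\mathsf A}\subset\mathbb Z$ to the positive bounded operators on $\mathcal H$ with $\sum_x\mathsf A(x)=\mathbb 1$. A set $\mathcal A$ of observables is informationally complete if any two states $\varrho,\sigma$ with $\operatorname{tr}[\varrho\,\mathsf A(x)]=\operatorname{tr}[\sigma\,\mathsf A(x)]$ for all $\mathsf A\in\mathcal A$ and $x\in\Omega_{\mathsf A}$ are equal; an observable $\mathsf A$ is informationally complete if $\{\mathsf A\}$ is. The set $\mathcal A$ is broadcastable if there is a channel (a completely positive trace preserving linear map on trace class operators) $\Lambda$ from $\mathcal H$ to $\mathcal H\otimes\mathcal H$ such that $$\operatorname{tr}[\varrho\,\mathsf A(x)]=\operatorname{tr}[\Lambda(\varrho)\,(\mathsf A(x)\otimes\mathbb 1)]=\operatorname{tr}[\Lambda(\varrho)\,(\mathbb 1\otimes\mathsf A(x))]$$ for all $\mathsf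 A\in\mathcal A$, $x\in\Omega_{\mathsf A}$ and all states $\varrho$. Then: 1. No informationally complete set of observables is broadcastable. 2. If $\mathsf A$ is an informationally complete observable, then $\{\mathsf A\}$ is not broadcastable, and for every observable $\mathsf B$ (including $\mathsf B=\mathsf A$) the set $\{\mathsf A,\mathsf B\}$ is not broadcastable. That is, $\mathsf A$ is an isolated element of the broadcasting relation, in which $\mathsf A$ and $\mathsf B$ are related if and only if $\{\mathsf A,\mathsf B\}$ is broadcastable. -/

import Mathlib

open scoped TensorProduct InnerProductSpace ComplexOrder

noncomputable section

namespace ObservableBroadcasting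

universe u v

variable (H : Type u) [NormedAddCommGroup H] [InnerProductSpace ℂ H] [CompleteSpace H]
variable (K : Type v) [NormedAddCommGroup K] [InnerProductSpace ℂ K] [CompleteSpace K]

/-! ### Trace class operators, trace and states -/

/-- The index set of a fixed Hilbert (orthonormal) basis of `H`. -/
def basisIndex : Set H := (exists_hilbertBasis ℂ H).choose

/-- A fixed Hilbert (orthonormal) basis of `H`. -/
def stdBasis : HilbertBasis (basisIndex H) ℂ H := (exists_hilbertBasis ℂ H).choose_spec.choose

variable {H K} in
/-- The trace `∑ i, ⟪b i, T (b i)⟫`, computed in a fixed orthonormal basis `b`. For trace class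
operators the sum converges absolutely and does not depend on the basis. -/
def trace (T : H →L[ℂ] H) : ℂ := ∑' i, ⟪stdBasis H i, T (stdBasis H i)⟫_ℂ

/-- The trace class operators on `H`: the linear span of the positive bounded operators with
finite trace. -/
def TraceClass : Submodule ℂ (H →L[ℂ] H) :=
  Submodule.span ℂ {T | T.IsPositive ∧ Summable fun i => ⟪stdBasis H i, T (stdBasis H i)⟫_ℂ}

variable {H K} in
/-- A state (density operator): a positive trace class operator of trace one. -/
def IsState (ρ : TraceClass H) : Prop :=
  (ρ : H →L[ℂ] H).IsPositive ∧ trace (ρ : H →L[ℂ] H) = 1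

/-! ### Tensor products -/

/-- The Hilbert space tensor product: the completion of the algebraic tensor product with respect
to the inner product with `⟪x ⊗ y, x' ⊗ y'⟫ = ⟪x, x'⟫ * ⟪y, y'⟫`. -/
abbrev HilbertTensor : Type (max u v) := UniformSpace.Completion (H ⊗[ℂ] K)

variable {H K} in
/-- The bounded operator `A ⊗ B` on the Hilbert space tensor product, that is, the continuous
extension of `x ⊗ y ↦ A x ⊗ B y`. -/
def tensorOp (A : H →L[ℂ] H) (B : K →L[ℂ] K) : HilbertTensor H K →L[ℂ] HilbertTensor H K :=
  (TensorProduct.mapL A B).completion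

/-! ### Channels -/

variable {H K} in
/-- Positivity of an `n × n` matrix of operators, regarded as an operator on `H ⊗ ℂⁿ`, the direct
sum of `n` copies of `H`. (The order on `ℂ` makes `0 ≤ z` say that `z` is real and
nonnegative.) -/
def IsBlockPositive {n : ℕ} (T : Fin n → Fin n → (H →L[ℂ] H)) : Prop :=
  ∀ v : Fin n → H, 0 ≤ ∑ i, ∑ j, ⟪v i, T i j (v j)⟫_ℂ

/-- A quantum channel from `H` to `K` (Schrödinger picture): a completely positive and trace
preserving linear map on the trace class operators. It hence maps states to states. -/
structure Channel where
  /-- the underlying linear map -/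
  map : TraceClass H →ₗ[ℂ] TraceClass K
  completelyPositive : ∀ (n : ℕ) (T : Fin n → Fin n → TraceClass H),
    IsBlockPositive (fun i j => (T i j : H →L[ℂ] H)) →
      IsBlockPositive (fun i j => (map (T i j) : K →L[ℂ] K))
  trace_map : ∀ T : TraceClass H, trace (map T : K →L[ℂ] K) = trace (T : H →L[ℂ] H)

/-! ### Observables -/

/-- An observable on `H`: a positive operator valued measure with a finite outcome set, which is a
subset of `ℤ`. -/
structure Observable where
  /-- the outcome set -/
  outcomes : Finset ℤ
  /-- the positive operator belonging to an outcome -/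
  effect : outcomes → (H →L[ℂ] H)
  isPositive : ∀ x, (effect x).IsPositive
  sum_effect : ∑ x, effect x = ContinuousLinearMap.id ℂ H

variable {H}

/-- A set of observables is informationally complete if any two states with the same measurement
outcome probabilities `tr (ρ A(x))` for all its observables and outcomes are equal. -/
def InformationallyComplete (𝒜 : Set (Observable H)) : Prop :=
  ∀ ρ σ : TraceClass H, IsState ρ → IsState σ →
    (∀ A ∈ 𝒜, ∀ x, trace ((ρ : H →L[ℂ] H) ∘L A.effect x) =
      trace ((σ : H →L[ℂ] H) ∘L A.effect x)) → ρ = σ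

/-- The channel `Λ` from `H` to `H ⊗ H` broadcasts the observable `A`:
`tr (ρ A(x)) = tr (Λ(ρ) (A(x) ⊗ 1)) = tr (Λ(ρ) (1 ⊗ A(x)))` for all states `ρ` and outcomes `x`. -/
def Channel.Broadcasts (Λ : Channel H (HilbertTensor H H)) (A : Observable H) : Prop :=
  ∀ ρ : TraceClass H, IsState ρ → ∀ x,
    trace ((ρ : H →L[ℂ] H) ∘L A.effect x) =
      trace ((Λ.map ρ : HilbertTensor H H →L[ℂ] HilbertTensor H H) ∘L
        tensorOp (A.effect x) (ContinuousLinearMap.id ℂ H)) ∧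
    trace ((ρ : H →L[ℂ] H) ∘L A.effect x) =
      trace ((Λ.map ρ : HilbertTensor H H →L[ℂ] HilbertTensor H H) ∘L
        tensorOp (ContinuousLinearMap.id ℂ H) (A.effect x))

/-- A set of observables is broadcastable if a single channel broadcasts all its elements. -/
def Broadcastable (𝒜 : Set (Observable H)) : Prop :=
  ∃ Λ : Channel H (HilbertTensor H H), ∀ A ∈ 𝒜, Λ.Broadcasts A

/-- The broadcasting relation on observables: `A` and `B` are broadcastable. -/
def BroadcastRel (A B : Observable H) : Prop := Broadcastable {A, B}

/-- `a` is isolated for the relation `R`: it is not related to any element, itself included. -/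
def IsIsolated {α : Type u} (R : α → α → Prop) (a : α) : Prop := ∀ b, ¬ R a b ∧ ¬ R b a

end ObservableBroadcasting

end

noncomputable section

namespace ObservableBroadcasting

section TraceTheory

open ContinuousLinearMap

/-! ### Hilbert-Schmidt sums -/

/-! Broadcasting an informationally complete set forces both marginals of `Λ(ρ)` to equal `ρ`: each
marginal is a state with the same outcome probabilities as `ρ` (`IsPositive.exists_partialTrace`,
`InformationallyComplete.apply_eq_zero`). If `ρ` is the pure state of a unit vector `p`, a positive
operator with these marginals kills `x ⊗ y` as soon as `x` or `y` is orthogonal to `p`, so it is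
determined by its value on `p ⊗ p`.

Now take `e`, `f` orthonormal and `p`, `m` the normalized `e ± f`. Both pairs of pure states sum to
the projection onto the same plane, so `Λ` sends them to the same operator. On the `e`, `f` side
this operator kills `e ⊗ f`, hence by positivity so does the image of `p`. As `e ⊗ f` is not
orthogonal to `p ⊗ p`, that image is zero, although its trace is one. -/

theorem hasSum_norm_inner_sq {E ι : Type*} [NormedAddCommGroup E] [InnerProductSpace ℂ E]
    (b : HilbertBasis ι ℂ E) (v : E) :
    HasSum (fun i => ‖⟪b i, v⟫_ℂ‖ ^ 2) (‖v‖ ^ 2) := by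
  have h := Complex.hasSum_re (b.hasSum_inner_mul_inner v v)
  rw [← RCLike.re_eq_complex_re, inner_self_eq_norm_sq] at h
  convert h using 2 with i
  rw [← inner_conj_symm v, RCLike.conj_mul, ← RCLike.ofReal_pow, RCLike.ofReal_re]

theorem summable_inner_of_summable_norm_sq {E ι : Type*} [NormedAddCommGroup E]
    [InnerProductSpace ℂ E] {u v : ι → E}
    (hu : Summable fun i => ‖u i‖ ^ 2) (hv : Summable fun i => ‖v i‖ ^ 2) :
    Summable fun i => ⟪u i, v i⟫_ℂ := by
  refine Summable.of_norm_bounded (hu.add hv) fun i => (norm_inner_le_norm _ _).trans ?_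
  nlinarith [sq_nonneg (‖u i‖ - ‖v i‖), sq_nonneg ‖u i‖, sq_nonneg ‖v i‖]

theorem summable_norm_inner_sq_prod {E F ι κ : Type*} [NormedAddCommGroup E]
    [InnerProductSpace ℂ E] [NormedAddCommGroup F] [InnerProductSpace ℂ F]
    (b : HilbertBasis ι ℂ E) (d : HilbertBasis κ ℂ F)
    {X : E →L[ℂ] F} (hX : Summable fun i => ‖X (b i)‖ ^ 2) :
    Summable fun p : ι × κ => ‖⟪d p.2, X (b p.1)⟫_ℂ‖ ^ 2 := by
  have h0 : 0 ≤ fun p : ι × κ => ‖⟪d p.2, X (b p.1)⟫_ℂ‖ ^ 2 := fun p => by positivity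
  have h1 : ∀ i, Summable fun j => ‖⟪d j, X (b i)⟫_ℂ‖ ^ 2 := fun i =>
    (hasSum_norm_inner_sq d (X (b i))).summable
  have h2 : Summable fun i => ∑' j, ‖⟪d j, X (b i)⟫_ℂ‖ ^ 2 :=
    hX.congr fun i => (hasSum_norm_inner_sq d (X (b i))).tsum_eq.symm
  exact (summable_prod_of_nonneg h0).mpr ⟨h1, h2⟩

theorem isPositive_of_inner_nonneg {E : Type*} [NormedAddCommGroup E]
    [InnerProductSpace ℂ E] {W : E →L[ℂ] E} (h : ∀ x, 0 ≤ ⟪x, W x⟫_ℂ) :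
    W.IsPositive := by
  refine (isPositive_iff_complex _).mpr fun x => ?_
  obtain ⟨hre, him⟩ := Complex.nonneg_iff.mp (h x)
  rw [← inner_conj_symm (W x) x, Complex.conj_eq_iff_im.mpr him.symm]
  exact ⟨Complex.ext rfl him, hre⟩

variable {E : Type*} [NormedAddCommGroup E] [InnerProductSpace ℂ E] [CompleteSpace E]
variable {F : Type*} [NormedAddCommGroup F] [InnerProductSpace ℂ F] [CompleteSpace F]
variable {ι κ : Type*}

/-- By Parseval both sums are the double sum of `‖⟪d j, X (b i)⟫‖ ^ 2`. For self-adjoint `X` this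
makes the Hilbert-Schmidt condition independent of the basis. -/
theorem summable_norm_adjoint_sq (b : HilbertBasis ι ℂ E) (d : HilbertBasis κ ℂ F)
    {X : E →L[ℂ] F} (hX : Summable fun i => ‖X (b i)‖ ^ 2) :
    Summable fun j => ‖adjoint X (d j)‖ ^ 2 := by
  have h := ((Equiv.prodComm κ ι).summable_iff.mpr (summable_norm_inner_sq_prod b d hX)).prod
  refine h.congr fun j => ?_
  rw [← (hasSum_norm_inner_sq b (adjoint X (d j))).tsum_eq]
  refine tsum_congr fun i => ?_
  simp only [Function.comp, Equiv.prodComm_apply, Prod.swap]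
  rw [adjoint_inner_right, norm_inner_symm]

theorem tsum_inner_eq_tsum_inner_adjoint (b : HilbertBasis ι ℂ E) (d : HilbertBasis κ ℂ F)
    {X Y : E →L[ℂ] F} (hX : Summable fun i => ‖X (b i)‖ ^ 2)
    (hY : Summable fun i => ‖Y (b i)‖ ^ 2) :
    ∑' i, ⟪X (b i), Y (b i)⟫_ℂ = ∑' j, ⟪adjoint Y (d j), adjoint X (d j)⟫_ℂ := by
  have hs : Summable (Function.uncurry fun i j => ⟪X (b i), d j⟫_ℂ * ⟪d j, Y (b i)⟫_ℂ) := by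
    have h := summable_inner_of_summable_norm_sq (summable_norm_inner_sq_prod b d hX)
      (summable_norm_inner_sq_prod b d hY)
    refine h.congr ?_
    rintro ⟨i, j⟩
    rw [RCLike.inner_apply, inner_conj_symm, mul_comm, Function.uncurry_apply_pair]
  calc ∑' i, ⟪X (b i), Y (b i)⟫_ℂ
      = ∑' i, ∑' j, ⟪X (b i), d j⟫_ℂ * ⟪d j, Y (b i)⟫_ℂ :=
        tsum_congr fun i => (d.tsum_inner_mul_inner _ _).symm
    _ = ∑' j, ∑' i, ⟪X (b i), d j⟫_ℂ * ⟪d j, Y (b i)⟫_ℂ := hs.tsum_comm.symm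
    _ = ∑' j, ⟪adjoint Y (d j), adjoint X (d j)⟫_ℂ := by
        refine tsum_congr fun j => ?_
        rw [← b.tsum_inner_mul_inner]
        refine tsum_congr fun i => ?_
        rw [adjoint_inner_left, adjoint_inner_right, mul_comm]

/-! ### Traces of products with a positive trace class operator -/

theorem exists_selfAdjoint_sqrt {W : E →L[ℂ] E} (hW : W.IsPositive) :
    ∃ S : E →L[ℂ] E, adjoint S = S ∧ S ∘L S = W := by
  have h0 : 0 ≤ W := (nonneg_iff_isPositive W).mpr hW
  exact ⟨CFC.sqrt W, ((nonneg_iff_isPositive _).mp (CFC.sqrt_nonneg W)).isSelfAdjoint.adjoint_eq,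
    CFC.sqrt_mul_sqrt_self W h0⟩

theorem inner_apply_eq_norm_sq {W S : E →L[ℂ] E} (hS : adjoint S = S) (hSW : S ∘L S = W)
    (x y : E) : ⟪x, W y⟫_ℂ = ⟪S x, S y⟫_ℂ := by
  rw [← hSW, comp_apply, ← adjoint_inner_left, hS]

theorem summable_norm_sqrt_sq {W S : E →L[ℂ] E} (hS : adjoint S = S) (hSW : S ∘L S = W)
    (b : HilbertBasis ι ℂ E) (h : Summable fun i => ⟪b i, W (b i)⟫_ℂ) :
    Summable fun i => ‖S (b i)‖ ^ 2 := by
  refine (Complex.hasSum_re h.hasSum).summable.congr fun i => ?_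
  rw [inner_apply_eq_norm_sq hS hSW, ← RCLike.re_eq_complex_re, inner_self_eq_norm_sq]

/-- Taking adjoints moves `B` to the left, where its operator norm bounds each term. -/
theorem summable_norm_comp_sq (b : HilbertBasis ι ℂ E) {S : E →L[ℂ] F}
    (h : Summable fun i => ‖S (b i)‖ ^ 2) (B : E →L[ℂ] E) :
    Summable fun i => ‖(S ∘L B) (b i)‖ ^ 2 := by
  obtain ⟨w, d, -⟩ := exists_hilbertBasis ℂ F
  have h2 : Summable fun j => ‖adjoint (S ∘L B) (d j)‖ ^ 2 := by
    refine Summable.of_nonneg_of_le (fun j => by positivity) (fun j => ?_)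
      ((summable_norm_adjoint_sq b d h).mul_left (‖adjoint B‖ ^ 2))
    rw [adjoint_comp, ← mul_pow]
    gcongr
    exact (adjoint B).le_opNorm _
  simpa only [adjoint_adjoint] using summable_norm_adjoint_sq d b h2

theorem IsPositive.summable_inner_comp {W : E →L[ℂ] E} (hW : W.IsPositive)
    (b : HilbertBasis ι ℂ E) (d : HilbertBasis κ ℂ E)
    (h : Summable fun i => ⟪b i, W (b i)⟫_ℂ) (B : E →L[ℂ] E) :
    Summable fun j => ⟪d j, W (B (d j))⟫_ℂ := by
  obtain ⟨S, hS, hSW⟩ := exists_selfAdjoint_sqrt hW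
  have hd : Summable fun j => ‖S (d j)‖ ^ 2 := by
    simpa only [hS] using summable_norm_adjoint_sq b d (summable_norm_sqrt_sq hS hSW b h)
  simpa only [inner_apply_eq_norm_sq hS hSW, comp_apply] using
    summable_inner_of_summable_norm_sq hd (summable_norm_comp_sq d hd B)

/-- With `W = S ∘ S`, both sums equal the one of `⟪(S B)* d j, S d j⟫`: pass to adjoints once from
`b` to `d` and once from `d` to itself. -/
theorem IsPositive.tsum_inner_comp_eq {W : E →L[ℂ] E} (hW : W.IsPositive)
    (b : HilbertBasis ι ℂ E) (d : HilbertBasis κ ℂ E)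
    (h : Summable fun i => ⟪b i, W (b i)⟫_ℂ) (B : E →L[ℂ] E) :
    ∑' i, ⟪b i, W (B (b i))⟫_ℂ = ∑' j, ⟪d j, W (B (d j))⟫_ℂ := by
  obtain ⟨S, hS, hSW⟩ := exists_selfAdjoint_sqrt hW
  have hb := summable_norm_sqrt_sq hS hSW b h
  have hd : Summable fun j => ‖S (d j)‖ ^ 2 := by
    simpa only [hS] using summable_norm_adjoint_sq b d hb
  have h1 := tsum_inner_eq_tsum_inner_adjoint b d hb (summable_norm_comp_sq b hb B)
  have h2 := tsum_inner_eq_tsum_inner_adjoint d d hd (summable_norm_comp_sq d hd B)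
  simpa only [inner_apply_eq_norm_sq hS hSW, comp_apply] using h1.trans h2.symm

/-- Cauchy-Schwarz on the coefficients `⟪S (b i), x⟫` bounds `‖S‖ ^ 2` by the trace. This gives norm
convergence of the partial trace series. -/
theorem IsPositive.opNorm_le_tsum {W : E →L[ℂ] E} (hW : W.IsPositive)
    (b : HilbertBasis ι ℂ E) (h : Summable fun i => ⟪b i, W (b i)⟫_ℂ) :
    ‖W‖ ≤ ∑' i, (⟪b i, W (b i)⟫_ℂ).re := by
  obtain ⟨S, hS, hSW⟩ := exists_selfAdjoint_sqrt hW
  have hb := summable_norm_sqrt_sq hS hSW b h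
  have he : ∀ i, (⟪b i, W (b i)⟫_ℂ).re = ‖S (b i)‖ ^ 2 := fun i => by
    rw [inner_apply_eq_norm_sq hS hSW, ← RCLike.re_eq_complex_re, inner_self_eq_norm_sq]
  simp only [he]
  have hM : 0 ≤ ∑' i, ‖S (b i)‖ ^ 2 := tsum_nonneg fun i => by positivity
  have hle : ∀ x, ‖S x‖ ^ 2 ≤ (∑' i, ‖S (b i)‖ ^ 2) * ‖x‖ ^ 2 := fun x => by
    rw [← (hasSum_norm_inner_sq b (S x)).tsum_eq, ← tsum_mul_right]
    refine Summable.tsum_le_tsum (fun i => ?_) (hasSum_norm_inner_sq b (S x)).summable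
      (hb.mul_right _)
    rw [← adjoint_inner_left, hS, ← mul_pow]
    gcongr
    exact norm_inner_le_norm _ _
  have hSn : ‖S‖ ≤ √(∑' i, ‖S (b i)‖ ^ 2) := by
    refine opNorm_le_bound _ (Real.sqrt_nonneg _) fun x => ?_
    refine abs_le_of_sq_le_sq' ?_ (by positivity) |>.2
    rw [mul_pow, Real.sq_sqrt hM]
    exact hle x
  calc ‖W‖ = ‖S ∘L S‖ := by rw [hSW]
    _ ≤ ‖S‖ * ‖S‖ := opNorm_comp_le _ _
    _ ≤ √(∑' i, ‖S (b i)‖ ^ 2) * √(∑' i, ‖S (b i)‖ ^ 2) := by gcongr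
    _ = _ := Real.mul_self_sqrt hM

theorem IsPositive.apply_eq_zero {W : E →L[ℂ] E} (hW : W.IsPositive) {x : E}
    (h : ⟪x, W x⟫_ℂ = 0) : W x = 0 := by
  obtain ⟨S, hS, hSW⟩ := exists_selfAdjoint_sqrt hW
  rw [inner_apply_eq_norm_sq hS hSW, inner_self_eq_zero] at h
  rw [← hSW, comp_apply, h, map_zero]

theorem summable_inner_of_mem_traceClass {T : E →L[ℂ] E} (hT : T ∈ TraceClass E) :
    Summable fun i => ⟪stdBasis E i, T (stdBasis E i)⟫_ℂ := by
  refine Submodule.span_induction (fun x hx => hx.2) ?_ (fun x y _ _ hx hy => ?_)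
    (fun a x _ hx => ?_) hT
  · simp
  · simpa [inner_add_right] using hx.add hy
  · simpa [inner_smul_right] using hx.mul_left a

/-! ### Partial traces -/

/-- The partial trace is `∑ j, (V j)* W (V j)`, norm convergent because the traces of its positive
terms sum to that of `W`. Leaving the `V j` abstract covers both marginals: they will be `x ↦ x ⊗ d
j` or `x ↦ d j ⊗ x`. -/
theorem IsPositive.exists_partialTrace {W : F →L[ℂ] F} (hW : W.IsPositive)
    (hWt : W ∈ TraceClass F) (V : κ → E →L[ℂ] F)
    (c : HilbertBasis (basisIndex E × κ) ℂ F) (hc : ∀ i j, c (i, j) = V j (stdBasis E i)) :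
    ∃ σ : TraceClass E, (σ : E →L[ℂ] E).IsPositive ∧
      (∀ x, HasSum (fun j => ⟪V j x, W (V j x)⟫_ℂ) ⟪x, (σ : E →L[ℂ] E) x⟫_ℂ) ∧
      ∀ (A : E →L[ℂ] E) (B : F →L[ℂ] F), (∀ j, B ∘L V j = V j ∘L A) →
        trace ((σ : E →L[ℂ] E) ∘L A) = trace (W ∘L B) := by
  have hs := summable_inner_of_mem_traceClass hWt
  have hprod : ∀ B : F →L[ℂ] F, Summable fun p : basisIndex E × κ => ⟪c p, W (B (c p))⟫_ℂ :=
    fun B => IsPositive.summable_inner_comp hW (stdBasis F) c hs B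
  have hprod1 := hprod (ContinuousLinearMap.id ℂ F)
  simp only [id_apply] at hprod1
  have hswap := (Equiv.prodComm κ (basisIndex E)).summable_iff.mpr hprod1
  let T : κ → E →L[ℂ] E := fun j => adjoint (V j) ∘L W ∘L V j
  have hTpos : ∀ j, (T j).IsPositive := fun j => hW.adjoint_conj (V j)
  have hTi : ∀ j x y, ⟪x, T j y⟫_ℂ = ⟪V j x, W (V j y)⟫_ℂ := fun j x y => by
    simp only [T, comp_apply, adjoint_inner_right]
  have hTc : ∀ j i, ⟪stdBasis E i, T j (stdBasis E i)⟫_ℂ = ⟪c (i, j), W (c (i, j))⟫_ℂ :=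
    fun j i => by rw [hTi, hc]
  have hTs : ∀ j, Summable fun i => ⟪stdBasis E i, T j (stdBasis E i)⟫_ℂ := fun j => by
    simp only [hTc]
    exact hswap.prod_factor j
  have hTsum : Summable T := by
    refine Summable.of_norm_bounded (Complex.hasSum_re hswap.hasSum).summable.prod fun j => ?_
    refine (IsPositive.opNorm_le_tsum (hTpos j) (stdBasis E) (hTs j)).trans_eq ?_
    simp only [hTc]
    rfl
  have hσ : ∀ x y, HasSum (fun j => ⟪V j x, W (V j y)⟫_ℂ) ⟪x, (∑' j, T j) y⟫_ℂ := fun x y => by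
    have := (((ContinuousLinearMap.apply ℂ E y).hasSum hTsum.hasSum)).mapL (innerSL ℂ x)
    simpa [hTi, Function.comp_def] using this
  have hpos : (∑' j, T j).IsPositive := by
    exact isPositive_of_inner_nonneg fun x => (hσ x x).nonneg fun j => hW.inner_nonneg_right _
  refine ⟨⟨∑' j, T j, Submodule.subset_span ⟨hpos, ?_⟩⟩, hpos, fun x => hσ x x, ?_⟩
  · refine hprod1.prod.congr fun i => ?_
    rw [← (hσ _ _).tsum_eq]
    simp only [hc]
  · intro A B hAB
    have h1 : trace (W ∘L B) = ∑' p, ⟪c p, W (B (c p))⟫_ℂ :=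
      IsPositive.tsum_inner_comp_eq hW (stdBasis F) c hs B
    rw [h1, (hprod B).tsum_prod]
    refine tsum_congr fun i => ?_
    rw [comp_apply, ← (hσ _ _).tsum_eq]
    refine tsum_congr fun j => ?_
    rw [hc, ← comp_apply B, hAB, comp_apply]

end TraceTheory

/-! ### Product bases and density of elementary tensors -/

section TensorBasis

variable {H K : Type*} [NormedAddCommGroup H] [InnerProductSpace ℂ H]
variable [NormedAddCommGroup K] [InnerProductSpace ℂ K]
variable {ι κ : Type*}

theorem eq_top_of_hilbertBasis_mem (b : HilbertBasis ι ℂ H) {U : Submodule ℂ H}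
    (hU : IsClosed (U : Set H)) (h : ∀ i, b i ∈ U) : U = ⊤ := by
  rw [eq_top_iff, ← b.dense_span]
  refine Submodule.topologicalClosure_minimal _ (Submodule.span_le.mpr ?_) hU
  rintro _ ⟨i, rfl⟩
  exact h i

theorem eq_zero_of_hilbertBasis_apply_eq_zero (b : HilbertBasis ι ℂ H) {T : H →L[ℂ] K}
    (h : ∀ i, T (b i) = 0) : T = 0 := by
  have := eq_top_of_hilbertBasis_mem b (U := T.ker) T.isClosed_ker h
  ext x
  exact (this ▸ Submodule.mem_top : x ∈ T.ker)

/-- The continuous linear map `x ↦ x ⊗ y` into the Hilbert space tensor product. -/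
def tensorRight (H : Type*) [NormedAddCommGroup H] [InnerProductSpace ℂ H] (y : K) :
    H →L[ℂ] HilbertTensor H K :=
  UniformSpace.Completion.toComplL ∘L (TensorProduct.mkL ℂ H K).flip y

/-- The continuous linear map `y ↦ x ⊗ y` into the Hilbert space tensor product. -/
def tensorLeft (K : Type*) [NormedAddCommGroup K] [InnerProductSpace ℂ K] (x : H) :
    K →L[ℂ] HilbertTensor H K :=
  UniformSpace.Completion.toComplL ∘L TensorProduct.mkL ℂ H K x

theorem tensorRight_apply (x : H) (y : K) :
    tensorRight H y x = ((x ⊗ₜ[ℂ] y : H ⊗[ℂ] K) : HilbertTensor H K) := rfl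

theorem tensorLeft_apply (x : H) (y : K) :
    tensorLeft K x y = ((x ⊗ₜ[ℂ] y : H ⊗[ℂ] K) : HilbertTensor H K) := rfl

theorem tensorOp_comp_tensorRight (A : H →L[ℂ] H) (y : K) :
    tensorOp A (ContinuousLinearMap.id ℂ K) ∘L tensorRight H y = tensorRight H y ∘L A := by
  ext x
  simp [tensorOp, tensorRight_apply]

theorem tensorOp_comp_tensorLeft (B : K →L[ℂ] K) (x : H) :
    tensorOp (ContinuousLinearMap.id ℂ H) B ∘L tensorLeft K x = tensorLeft K x ∘L B := by
  ext x
  simp [tensorOp, tensorLeft_apply]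

theorem eq_top_of_tmul_mem {U : Submodule ℂ (HilbertTensor H K)}
    (hU : IsClosed (U : Set (HilbertTensor H K)))
    (h : ∀ (x : H) (y : K), ((x ⊗ₜ[ℂ] y : H ⊗[ℂ] K) : HilbertTensor H K) ∈ U) : U = ⊤ := by
  have hspan : (⊤ : Submodule ℂ (H ⊗[ℂ] K)) ≤
      U.comap (UniformSpace.Completion.toComplL (𝕜 := ℂ) (E := H ⊗[ℂ] K)).toLinearMap := by
    rw [← TensorProduct.span_tmul_eq_top, Submodule.span_le]
    rintro _ ⟨x, y, rfl⟩
    exact h x y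
  refine eq_top_iff.mpr fun z _ => ?_
  exact UniformSpace.Completion.induction_on z hU fun t => hspan (Submodule.mem_top (x := t))

/-- The product of Hilbert bases, a Hilbert basis of the Hilbert space tensor product. -/
theorem exists_hilbertBasis_tensor (b : HilbertBasis ι ℂ H) (d : HilbertBasis κ ℂ K) :
    ∃ c : HilbertBasis (ι × κ) ℂ (HilbertTensor H K),
      ∀ i j, c (i, j) = ((b i ⊗ₜ[ℂ] d j : H ⊗[ℂ] K) : HilbertTensor H K) := by
  classical
  let v : ι × κ → HilbertTensor H K := fun p =>
    ((b p.1 ⊗ₜ[ℂ] d p.2 : H ⊗[ℂ] K) : HilbertTensor H K)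
  have hv : Orthonormal ℂ v := by
    rw [orthonormal_iff_ite]
    rintro ⟨i, j⟩ ⟨i', j'⟩
    simp only [v, UniformSpace.Completion.inner_coe, TensorProduct.inner_tmul,
      orthonormal_iff_ite.mp b.orthonormal, orthonormal_iff_ite.mp d.orthonormal, Prod.mk.injEq,
      ite_and, mul_ite, mul_one, mul_zero]
    split_ifs <;> rfl
  let U := (Submodule.span ℂ (Set.range v)).topologicalClosure
  have hU : IsClosed (U : Set (HilbertTensor H K)) := Submodule.isClosed_topologicalClosure _
  have h1 : ∀ i (y : K), tensorLeft K (b i) y ∈ U := fun i y => by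
    have := eq_top_of_hilbertBasis_mem d (U := U.comap (tensorLeft K (b i)).toLinearMap)
      (hU.preimage (tensorLeft K (b i)).continuous)
      fun j => Submodule.le_topologicalClosure _ (Submodule.subset_span ⟨(i, j), rfl⟩)
    exact (this ▸ Submodule.mem_top : y ∈ U.comap (tensorLeft K (b i)).toLinearMap)
  have h2 : ∀ (x : H) (y : K), tensorRight H y x ∈ U := fun x y => by
    have := eq_top_of_hilbertBasis_mem b (U := U.comap (tensorRight H y).toLinearMap)
      (hU.preimage (tensorRight H y).continuous) fun i => h1 i y
    exact (this ▸ Submodule.mem_top : x ∈ U.comap (tensorRight H y).toLinearMap)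
  exact ⟨HilbertBasis.mk hv (eq_top_of_tmul_mem hU h2).ge, fun i j => by
    rw [HilbertBasis.coe_mk]⟩

theorem exists_hilbertBasis_reindex [CompleteSpace H] (c : HilbertBasis ι ℂ H) (e : κ ≃ ι) :
    ∃ c' : HilbertBasis κ ℂ H, ∀ k, c' k = c (e k) := by
  refine ⟨HilbertBasis.mk (c.orthonormal.comp e e.injective) ?_, fun k => ?_⟩
  · rw [Set.range_comp, e.range_eq_univ, Set.image_univ, c.dense_span]
  · rw [HilbertBasis.coe_mk, Function.comp_apply]

theorem eq_zero_of_tmul_apply_eq_zero {G : Type*} [NormedAddCommGroup G] [NormedSpace ℂ G]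
    {T : HilbertTensor H K →L[ℂ] G}
    (h : ∀ (x : H) (y : K), T ((x ⊗ₜ[ℂ] y : H ⊗[ℂ] K) : HilbertTensor H K) = 0) : T = 0 := by
  have := eq_top_of_tmul_mem (U := T.ker) T.isClosed_ker h
  ext x
  exact (this ▸ Submodule.mem_top : (x : HilbertTensor H K) ∈ T.ker)

end TensorBasis

/-! ### Pure states and orthonormal pairs -/

section PureStates

variable {H : Type*} [NormedAddCommGroup H] [InnerProductSpace ℂ H] [CompleteSpace H]

theorem hasSum_inner_rankOne (e : H) :
    HasSum (fun i => ⟪stdBasis H i, InnerProductSpace.rankOne ℂ e e (stdBasis H i)⟫_ℂ)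
      ⟪e, e⟫_ℂ := by
  simpa [inner_smul_right] using (stdBasis H).hasSum_inner_mul_inner e e

/-- The operator `|e⟩⟨e|`. -/
def pureState (e : H) : TraceClass H :=
  ⟨InnerProductSpace.rankOne ℂ e e, Submodule.subset_span
    ⟨InnerProductSpace.isPositive_rankOne_self e, (hasSum_inner_rankOne e).summable⟩⟩

theorem isState_pureState {e : H} (he : ‖e‖ = 1) : IsState (pureState e) :=
  ⟨InnerProductSpace.isPositive_rankOne_self e, (hasSum_inner_rankOne e).tsum_eq.trans
    (by rw [inner_self_eq_norm_sq_to_K, he]; simp)⟩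

theorem inner_pureState_eq_zero {e x : H} (h : ⟪e, x⟫_ℂ = 0) :
    ⟪x, (pureState e : H →L[ℂ] H) x⟫_ℂ = 0 := by
  simp [pureState, h]

theorem exists_orthonormal_pair {H : Type*} [NormedAddCommGroup H] [InnerProductSpace ℂ H]
    (hdim : 2 ≤ Module.rank ℂ H) : ∃ e f : H, ‖e‖ = 1 ∧ ‖f‖ = 1 ∧ ⟪e, f⟫_ℂ = 0 := by
  have h1 : 1 < Module.rank ℂ H := Cardinal.one_lt_two.trans_le hdim
  have : Nontrivial H := rank_pos_iff_nontrivial.mp (zero_lt_one.trans h1)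
  obtain ⟨x, hx⟩ := exists_ne (0 : H)
  obtain ⟨y, hxy⟩ := exists_linearIndependent_pair_of_one_lt_rank h1 hx
  have ho := InnerProductSpace.gramSchmidtNormed_orthonormal hxy
  exact ⟨_, _, ho.1 0, ho.1 1, ho.2 (by decide)⟩

end PureStates

/-! ### Marginals of a broadcasting channel and the contradiction -/

section Broadcasting

variable {H : Type*} [NormedAddCommGroup H] [InnerProductSpace ℂ H] [CompleteSpace H]
variable {K : Type*} [NormedAddCommGroup K] [InnerProductSpace ℂ K] [CompleteSpace K]

theorem Channel.isPositive_map (Λ : Channel H K) {ρ : TraceClass H}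
    (hρ : (ρ : H →L[ℂ] H).IsPositive) : (Λ.map ρ : K →L[ℂ] K).IsPositive := by
  have h := Λ.completelyPositive 1 (fun _ _ => ρ) fun v => by
    simpa using hρ.inner_nonneg_right (v 0)
  exact isPositive_of_inner_nonneg fun x => by simpa using h fun _ => x

theorem Channel.isState_map (Λ : Channel H K) {ρ : TraceClass H} (hρ : IsState ρ) :
    IsState (Λ.map ρ) :=
  ⟨Λ.isPositive_map hρ.1, (Λ.trace_map ρ).trans hρ.2⟩

/-- If the marginal of a state `ω` along the maps `V j` has the same outcome
probabilities as `ρ` for an informationally complete set, then `ω` vanishes on `V j x` whenever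
`ρ` vanishes on `x`. -/
theorem InformationallyComplete.apply_eq_zero {𝒜 : Set (Observable H)}
    (h𝒜 : InformationallyComplete 𝒜) {ρ : TraceClass H} (hρ : IsState ρ) {ω : TraceClass K}
    (hω : IsState ω) {κ : Type*} (V : κ → H →L[ℂ] K)
    (c : HilbertBasis (basisIndex H × κ) ℂ K) (hc : ∀ i j, c (i, j) = V j (stdBasis H i))
    (Φ : (H →L[ℂ] H) → K →L[ℂ] K) (hΦ : ∀ A j, Φ A ∘L V j = V j ∘L A)
    (h : ∀ A ∈ 𝒜, ∀ x, trace ((ρ : H →L[ℂ] H) ∘L A.effect x) =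
      trace ((ω : K →L[ℂ] K) ∘L Φ (A.effect x)))
    {x : H} (hx : ⟪x, (ρ : H →L[ℂ] H) x⟫_ℂ = 0) (j : κ) : (ω : K →L[ℂ] K) (V j x) = 0 := by
  obtain ⟨σ, hσ, hsum, htr⟩ := IsPositive.exists_partialTrace hω.1 ω.2 V c hc
  have hσ1 : trace (σ : H →L[ℂ] H) = 1 := by
    have := htr (ContinuousLinearMap.id ℂ H) (ContinuousLinearMap.id ℂ K) fun j => by simp
    simpa [hω.2] using this
  have hσρ : ρ = σ := h𝒜 ρ σ hρ ⟨hσ, hσ1⟩ fun A hA x =>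
    (h A hA x).trans (htr _ _ fun j => hΦ _ j).symm
  have h0 := hsum x
  rw [← hσρ, hx, hasSum_zero_iff_of_nonneg fun j => hω.1.inner_nonneg_right _] at h0
  exact IsPositive.apply_eq_zero hω.1 (congrFun h0 j)

variable {𝒜 : Set (Observable H)} {Λ : Channel H (HilbertTensor H H)}

theorem InformationallyComplete.map_tmul_left_eq_zero (h𝒜 : InformationallyComplete 𝒜)
    (hΛ : ∀ A ∈ 𝒜, Λ.Broadcasts A) {ρ : TraceClass H} (hρ : IsState ρ) {x : H}
    (hx : ⟪x, (ρ : H →L[ℂ] H) x⟫_ℂ = 0) (y : H) :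
    (Λ.map ρ : HilbertTensor H H →L[ℂ] HilbertTensor H H)
      ((x ⊗ₜ[ℂ] y : H ⊗[ℂ] H) : HilbertTensor H H) = 0 := by
  obtain ⟨c, hc⟩ := exists_hilbertBasis_tensor (stdBasis H) (stdBasis H)
  have hj := h𝒜.apply_eq_zero hρ (Λ.isState_map hρ) (fun j => tensorRight H (stdBasis H j)) c hc
    (fun A => tensorOp A (ContinuousLinearMap.id ℂ H))
    (fun A j => tensorOp_comp_tensorRight A _) (fun A hA i => (hΛ A hA ρ hρ i).1) hx
  -- `hj` covers basis vectors in the second factor; continuity extends it to all `y`.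
  exact congrArg (fun T : H →L[ℂ] HilbertTensor H H => T y)
    (eq_zero_of_hilbertBasis_apply_eq_zero (stdBasis H)
      (T := (Λ.map ρ : HilbertTensor H H →L[ℂ] HilbertTensor H H) ∘L tensorLeft H x) hj)

theorem InformationallyComplete.map_tmul_right_eq_zero (h𝒜 : InformationallyComplete 𝒜)
    (hΛ : ∀ A ∈ 𝒜, Λ.Broadcasts A) {ρ : TraceClass H} (hρ : IsState ρ) {y : H}
    (hy : ⟪y, (ρ : H →L[ℂ] H) y⟫_ℂ = 0) (x : H) :
    (Λ.map ρ : HilbertTensor H H →L[ℂ] HilbertTensor H H)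
      ((x ⊗ₜ[ℂ] y : H ⊗[ℂ] H) : HilbertTensor H H) = 0 := by
  obtain ⟨c, hc⟩ := exists_hilbertBasis_tensor (stdBasis H) (stdBasis H)
  -- The first factor is traced out here, so the index pairs are swapped.
  obtain ⟨c', hc'⟩ := exists_hilbertBasis_reindex c (Equiv.prodComm _ _)
  have hj := h𝒜.apply_eq_zero hρ (Λ.isState_map hρ) (fun j => tensorLeft H (stdBasis H j)) c'
    (fun i j => (hc' (i, j)).trans (hc j i))
    (fun A => tensorOp (ContinuousLinearMap.id ℂ H) A)
    (fun A j => tensorOp_comp_tensorLeft A _) (fun A hA i => (hΛ A hA ρ hρ i).2) hy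
  exact congrArg (fun T : H →L[ℂ] HilbertTensor H H => T x)
    (eq_zero_of_hilbertBasis_apply_eq_zero (stdBasis H)
      (T := (Λ.map ρ : HilbertTensor H H →L[ℂ] HilbertTensor H H) ∘L tensorRight H y) hj)

theorem InformationallyComplete.not_broadcastable (h𝒜 : InformationallyComplete 𝒜)
    (hdim : 2 ≤ Module.rank ℂ H) : ¬ Broadcastable 𝒜 := by
  rintro ⟨Λ, hΛ⟩
  obtain ⟨e, f, he, hf, hef⟩ := exists_orthonormal_pair hdim
  have hfe : ⟪f, e⟫_ℂ = 0 := inner_eq_zero_symm.mp hef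
  have hee : ⟪e, e⟫_ℂ = 1 := by rw [inner_self_eq_norm_sq_to_K, he]; simp
  have hff : ⟪f, f⟫_ℂ = 1 := by rw [inner_self_eq_norm_sq_to_K, hf]; simp
  -- `s = 1/√2` normalizes `e ± f`.
  obtain ⟨s, hs, hss⟩ : ∃ s : ℂ, starRingEnd ℂ s = s ∧ s * s = 1 / 2 := by
    refine ⟨((√(1 / 2) : ℝ) : ℂ), Complex.conj_ofReal _, ?_⟩
    rw [← Complex.ofReal_mul, Real.mul_self_sqrt (by norm_num)]
    norm_num
  let p := s • (e + f)
  let m := s • (e - f)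
  have hpp : ⟪p, p⟫_ℂ = 1 := by
    simp only [p, inner_smul_left, inner_smul_right, inner_add_left, inner_add_right, hee, hff,
      hef, hfe, hs]
    linear_combination 2 * hss
  have hpm : ⟪p, m⟫_ℂ = 0 := by
    simp only [p, m, inner_smul_left, inner_smul_right, inner_add_left, inner_sub_right, hee, hff,
      hef, hfe, hs]
    ring
  have hmm : ⟪m, m⟫_ℂ = 1 := by
    simp only [m, inner_smul_left, inner_smul_right, inner_sub_left, inner_sub_right, hee, hff,
      hef, hfe, hs]
    linear_combination 2 * hss
  have norm_one : ∀ x : H, ⟪x, x⟫_ℂ = 1 → ‖x‖ = 1 := fun x hx => by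
    rw [norm_eq_sqrt_re_inner (𝕜 := ℂ), hx]
    simp
  have hp := isState_pureState (norm_one p hpp)
  have hm := isState_pureState (norm_one m hmm)
  have hsum : pureState p + pureState m = pureState e + pureState f := by
    refine Subtype.ext (ContinuousLinearMap.ext fun x => ?_)
    simp only [pureState, p, m, Submodule.coe_add, add_apply,
      InnerProductSpace.rankOne_apply, inner_smul_left, inner_add_left, inner_sub_left, hs]
    match_scalars
    · linear_combination 2 * ⟪e, x⟫_ℂ * hss
    · linear_combination 2 * ⟪f, x⟫_ℂ * hss
  let t : H → H → HilbertTensor H H := fun x y => ((x ⊗ₜ[ℂ] y : H ⊗[ℂ] H) : HilbertTensor H H)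
  let W : H → HilbertTensor H H →L[ℂ] HilbertTensor H H := fun x => Λ.map (pureState x)
  have hW : W p + W m = W e + W f := by
    simpa only [map_add, Submodule.coe_add] using
      congrArg (fun ρ => (Λ.map ρ : HilbertTensor H H →L[ℂ] HilbertTensor H H)) hsum
  have hWp : (W p).IsPositive := Λ.isPositive_map hp.1
  have hWm : (W m).IsPositive := Λ.isPositive_map hm.1
  -- `e ⊗ f` is killed by `W e` through its second factor and by `W f` through its first.
  have hWe : W e (t e f) = 0 :=
    h𝒜.map_tmul_right_eq_zero hΛ (isState_pureState he) (inner_pureState_eq_zero hef) e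
  have hWf : W f (t e f) = 0 :=
    h𝒜.map_tmul_left_eq_zero hΛ (isState_pureState hf) (inner_pureState_eq_zero hfe) f
  have hpl : ∀ x y, ⟪p, x⟫_ℂ = 0 → W p (t x y) = 0 := fun x y hx =>
    h𝒜.map_tmul_left_eq_zero hΛ hp (inner_pureState_eq_zero hx) y
  have hpr : ∀ x y, ⟪p, y⟫_ℂ = 0 → W p (t x y) = 0 := fun x y hy =>
    h𝒜.map_tmul_right_eq_zero hΛ hp (inner_pureState_eq_zero hy) x
  -- `W p` annihilates everything orthogonal to `p ⊗ p`.
  have hdecomp : ∀ x y, W p (t x y) = (⟪p, x⟫_ℂ * ⟪p, y⟫_ℂ) • W p (t p p) := fun x y => by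
    have hperp : ∀ z : H, ⟪p, z - ⟪p, z⟫_ℂ • p⟫_ℂ = 0 := fun z => by
      rw [inner_sub_right, inner_smul_right, hpp, mul_one, sub_self]
    have h1 := hpl _ y (hperp x)
    have h2 := hpr p _ (hperp y)
    have e1 : t (x - ⟪p, x⟫_ℂ • p) y = t x y - ⟪p, x⟫_ℂ • t p y := by
      simp only [t, ← tensorRight_apply, map_sub, map_smul]
    have e2 : t p (y - ⟪p, y⟫_ℂ • p) = t p y - ⟪p, y⟫_ℂ • t p p := by
      simp only [t, ← tensorLeft_apply, map_sub, map_smul]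
    rw [e1, map_sub, map_smul, sub_eq_zero] at h1
    rw [e2, map_sub, map_smul, sub_eq_zero] at h2
    rw [h1, h2, smul_smul]
  -- Two nonnegative expectations at `e ⊗ f` sum to zero, so both vanish.
  have hzero : W p (t e f) = 0 := by
    refine IsPositive.apply_eq_zero hWp (le_antisymm ?_ (hWp.inner_nonneg_right _))
    have h0 : ⟪t e f, (W p + W m) (t e f)⟫_ℂ = 0 := by
      rw [hW, add_apply, hWe, hWf, add_zero, inner_zero_right]
    rw [add_apply, inner_add_right] at h0
    rw [eq_neg_of_add_eq_zero_left h0]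
    exact neg_nonpos.mpr (hWm.inner_nonneg_right _)
  have hWpp : W p (t p p) = 0 := by
    rw [hdecomp] at hzero
    -- The coefficient `⟪p, e⟫ * ⟪p, f⟫` is `s * s = 1 / 2`.
    refine (smul_eq_zero.mp hzero).resolve_left ?_
    simp only [p, inner_smul_left, inner_add_left, hee, hff, hef, hfe, hs, add_zero, zero_add,
      mul_one, hss]
    norm_num
  have hW0 : W p = 0 := eq_zero_of_tmul_apply_eq_zero fun x y => by
    rw [show ((x ⊗ₜ[ℂ] y : H ⊗[ℂ] H) : HilbertTensor H H) = t x y from rfl, hdecomp, hWpp,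
      smul_zero]
  have htr : trace (W p) = 1 := (Λ.isState_map hp).2
  simp [hW0, trace] at htr

end Broadcasting

end ObservableBroadcasting

end

open ObservableBroadcasting in
theorem mainTheorem6 (H : Type*) [NormedAddCommGroup H] [InnerProductSpace ℂ H] [CompleteSpace H]
    [TopologicalSpace.SeparableSpace H] (hdim : 2 ≤ Module.rank ℂ H) :
    (∀ 𝒜 : Set (Observable H), InformationallyComplete 𝒜 → ¬ Broadcastable 𝒜) ∧
    (∀ A : Observable H, InformationallyComplete {A} →
      ¬ Broadcastable {A} ∧
      (∀ B : Observable H, ¬ Broadcastable {A, B}) ∧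
      IsIsolated BroadcastRel A) := by
  refine ⟨fun 𝒜 h => h.not_broadcastable hdim, fun A hA => ?_⟩
  -- A channel that broadcasts the pair already broadcasts `A` alone.
  have hAB : ∀ B : Observable H, ¬ Broadcastable {A, B} := fun B ⟨Λ, hΛ⟩ =>
    hA.not_broadcastable hdim ⟨Λ, fun C hC => hΛ C (Or.inl hC)⟩
  refine ⟨hA.not_broadcastable hdim, hAB, fun B => ⟨hAB B, ?_⟩⟩
  rw [BroadcastRel, Set.pair_comm]
  exact hAB B
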